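/- Let $1\le K\le N$, let $g_1,\dots,g_N>0$ be channel gains and let $P>0$. A pattern (SAP) is a set $\mathcal S_i\subseteq\{1,\dots,N\}$ of $K$ active subcarriers; $i$ ranges over the index set $\mathcal U$ of all $\binom NK$ patterns. For pattern probabilities $\mathbf p=(p_i)$ (with $p_i\ge 0$, $\sum_i p_i=1$), powers $\boldsymbol\rho=(\rho_{li})$ and noise variance $\sigma^2>0$, let $\mathbf Y\in\mathbb C^N$ have the density $$f_{\mathbf Y}(\mathbf y)=\sum_{i\in\mathcal U}p_i\prod_{l\in\mathcal S_i}f_{\rm CN}(y_l;g_l\rho_{li}+\sigma^2)\prod_{m\notin\mathcal S_i}f_{\rm CN}(y_m;\sigma^2),\qquad f_{\rm CN}(t;\nu)=\frac{e^{-|t|^2/\nu}}{\pi\nu},$$ let $\mathbf Z$ have the density $\prod_l f_{\rm CN}(z_l;\sigma^2)$, and let $I(\mathbf p,\boldsymbol\rho,\sigma^2)=h(\mathbf Y)-h(\mathbf Z)$ be the mutual information, where $h$ denotes differential entropy. Powers are feasible if $\rho_{li}\ge0$ for $l\in\mathcal S_i$ and $\sum_{l\in\mathcal S_i}\rho_{li}\le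 P$, for every pattern $i$. Put $I^\star(\boldsymbol\rho,\sigma^2)=\sup_{\mathbf p}I(\mathbf p,\boldsymbol\rho,\sigma^2)$ and $I_{\rm opt}(\sigma^2)=\sup I^\star(\boldsymbol\rho,\sigma^2)$ over all feasible $\boldsymbol\rho$. The waterfilling allocation of power $P$ over $\mathcal S_i$ is $w_{li}=(c_i-\sigma^2/g_l)^+$, $l\in\mathcal S_i$, where the water level $c_i$ is such that $\sum_{l\in\mathcal S_i}w_{li}=P$; write $\mathbf w=\mathbf w(\sigma^2)$ for the allocation that uses waterfilling within each pattern separately. Call $i$ a strongest pattern for powers $\boldsymbol\rho$ if it maximizes $\sum_{l\in\mathcal S_i}\ln\left(\frac{g_l\rho_{li}}{\sigma^2}+1\right)$ over $i\in\mathcal U$. The entropy $h(\mathbf Y)$ is finite for all $\mathbf p$ and all feasible $\boldsymbol\rho$, the supremum $I_{\rm opt}(\sigma^2)$ is finite, $\mathbf w(\sigma^2)$ exists and is feasible, and the following hold. (a) High SNR. For every $\sigma^2>0$, $\mathbf w(\sigma^2)$ maximizes $\ln\left[\sum_{i\in\mathcal U}\prod_{l\in\mathcal S_i}\left(\frac{g_l\rho_{li}}{\sigma^2}+1\right)\right]$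 over all feasible $\boldsymbol\rho$, and waterfilling within each pattern is asymptotically optimal: $$I_{\rm opt}(\sigma^2)-I^\star(\mathbf w(\sigma^2),\sigma^2)\to0\quad\text{as }\sigma^2\to0.$$ (b) Low SNR. For every $\sigma^2>0$, a pattern consisting of $K$ subcarriers with the largest gains is a strongest pattern for the powers $\mathbf w(\sigma^2)$. Moreover $I^\star(\mathbf w(\sigma^2),\sigma^2)\sim I_{\rm opt}(\sigma^2)$ as $\sigma^2\to\infty$. If, for every $\sigma^2>0$, $i^\star=i^\star(\sigma^2)$ is a strongest pattern for the powers $\mathbf w(\sigma^2)$, then for every $\sigma^2>0$ waterfilling over $\mathcal S_{i^\star}$ attains the maximum of $\sum_{l\in\mathcal S_j}\ln\left(\frac{g_l\rho_{lj}}{\sigma^2}+1\right)$ over all feasible $\boldsymbol\rho$ and all patterns $j$, and always using pattern $i^\star$ with its waterfilling powers is asymptotically optimal: with $r_{i^\star}=1$ and $r_i=0$ for $i\ne i^\star$, $$I(\mathbf r,\mathbf w(\sigma^2),\sigma^2)\sim I_{\rm opt}(\sigma^2)\quad\text{as }\sigma^2\to\infty.$$ -/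

import Mathlib

open Filter Topology MeasureTheory

noncomputable section

/-- Subcarrier activation patterns (SAPs): the sets of `K` active subcarriers out of `N`. -/
abbrev SAP (N K : ℕ) : Type := {S : Finset (Fin N) // S.card = K}

/-- The density on `ℂ` of the circularly-symmetric complex Gaussian with mean zero and
variance `ν`. -/
def fCN (ν : ℝ) (t : ℂ) : ℝ := Real.exp (-‖t‖ ^ 2 / ν) / (Real.pi * ν)

/-- The density of the received vector `Y`, given that pattern `i` is used, when the channel gains
are `g`, the power on the active subcarrier `l` of pattern `i` is `ρ i l`, and the noise variance
is `v = σ²`. The values `ρ i l` with `l ∉ i` are never used. -/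
def densityYGiven {N K : ℕ} (g : Fin N → ℝ) (ρ : SAP N K → Fin N → ℝ) (v : ℝ) (i : SAP N K)
    (y : Fin N → ℂ) : ℝ :=
  (∏ l ∈ i.1, fCN (g l * ρ i l + v) (y l)) * ∏ m ∈ i.1ᶜ, fCN v (y m)

/-- The density of the received vector `Y` when pattern `i` has probability `p i`. -/
def densityY {N K : ℕ} (g : Fin N → ℝ) (p : SAP N K → ℝ) (ρ : SAP N K → Fin N → ℝ) (v : ℝ)
    (y : Fin N → ℂ) : ℝ :=
  ∑ i, p i * densityYGiven g ρ v i y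

/-- The density of the noise vector `Z`. -/
def densityZ (N : ℕ) (v : ℝ) (z : Fin N → ℂ) : ℝ := ∏ l, fCN v (z l)

/-- Differential entropy (in nats) of a density on `ℂ^N`. -/
def diffEntropy {N : ℕ} (f : (Fin N → ℂ) → ℝ) : ℝ := -∫ y, f y * Real.log (f y)

/-- The mutual information `I(X;Y) = h(Y) - h(Y|X) = h(Y) - h(Z)`, as a function of the pattern
probabilities `p`, the powers `ρ` and the noise variance `v = σ²`. -/
def mutualInfo {N K : ℕ} (g : Fin N → ℝ) (p : SAP N K → ℝ) (ρ : SAP N K → Fin N → ℝ)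
    (v : ℝ) : ℝ :=
  diffEntropy (densityY g p ρ v) - diffEntropy (densityZ N v)

/-- Feasible powers: nonnegative on the active subcarriers, total power at most `P` in each
pattern. -/
def FeasiblePowers {N K : ℕ} (P : ℝ) (ρ : SAP N K → Fin N → ℝ) : Prop :=
  ∀ i : SAP N K, (∀ l ∈ i.1, 0 ≤ ρ i l) ∧ ∑ l ∈ i.1, ρ i l ≤ P

/-- The values of the mutual information over all pattern probabilities, for given powers. -/
def valuesGivenPowers {N K : ℕ} (g : Fin N → ℝ) (ρ : SAP N K → Fin N → ℝ) (v : ℝ) : Set ℝ :=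
  {x | ∃ p ∈ stdSimplex ℝ (SAP N K), x = mutualInfo g p ρ v}

/-- The values of the mutual information over all pattern probabilities and feasible powers. -/
def feasibleValues {N : ℕ} (K : ℕ) (g : Fin N → ℝ) (P v : ℝ) : Set ℝ :=
  {x | ∃ p ∈ stdSimplex ℝ (SAP N K), ∃ ρ : SAP N K → Fin N → ℝ,
    FeasiblePowers P ρ ∧ x = mutualInfo g p ρ v}

/-- `I⋆(ρ, σ²)`: the mutual information for given powers, optimized over the pattern
probabilities. -/
def optMutualInfoGivenPowers {N K : ℕ} (g : Fin N → ℝ) (ρ : SAP N K → Fin N → ℝ) (v : ℝ) : ℝ :=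
  sSup (valuesGivenPowers g ρ v)

/-- The optimal value of the mutual information over pattern probabilities and powers. -/
def optMutualInfo {N : ℕ} (K : ℕ) (g : Fin N → ℝ) (P v : ℝ) : ℝ :=
  sSup (feasibleValues K g P v)

/-- `w` is the waterfilling allocation of total power `P` over the subcarriers in `S`: there is
a water level `c` with `w l = (c - σ² / g l)⁺` on `S`, chosen so that the powers sum to `P`. -/
def IsWaterfilling {N : ℕ} (g : Fin N → ℝ) (P v : ℝ) (S : Finset (Fin N)) (w : Fin N → ℝ) : Prop :=
  ∃ c : ℝ, (∀ l ∈ S, w l = max (c - v / g l) 0) ∧ ∑ l ∈ S, w l = P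

/-- The rate `∑_{l ∈ S_i} ln (g_l ρ_{li} / σ² + 1)` of the parallel channels of pattern `i`. -/
def patternRate {N K : ℕ} (g : Fin N → ℝ) (ρ : SAP N K → Fin N → ℝ) (v : ℝ) (i : SAP N K) : ℝ :=
  ∑ l ∈ i.1, Real.log (g l * ρ i l / v + 1)

/-- `i` is a strongest pattern for the powers `ρ`: it maximizes the rate of its parallel
channels. -/
def IsStrongestPattern {N K : ℕ} (g : Fin N → ℝ) (ρ : SAP N K → Fin N → ℝ) (v : ℝ)
    (i : SAP N K) : Prop :=
  ∀ j, patternRate g ρ v j ≤ patternRate g ρ v i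

/-- The closed-form high-SNR expression of `I⋆(ρ, σ²)`. -/
def highSNRInfo {N K : ℕ} (g : Fin N → ℝ) (ρ : SAP N K → Fin N → ℝ) (v : ℝ) : ℝ :=
  Real.log (∑ i : SAP N K, ∏ l ∈ i.1, (g l * ρ i l / v + 1))

end

noncomputable section

/-! ### Complex Gaussian densities -/

/-! Write `R i` for `patternRate`. Given the pattern, `Y` is Gaussian with entropy `h(Z) + R i`, so
`Y` is a Gaussian mixture, and everything rests on two upper bounds and one lower bound for its
mutual information.

High SNR. A mixture has entropy at most the mean component entropy plus the entropy of `p`. Hence `I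
≤ ∑ p i (R i - log p i) ≤ log ∑ exp (R i)`, which is `highSNRInfo` (`mutualInfo_le_highSNRInfo`).
This is increasing in every `R i`, so waterfilling in each pattern maximizes it. Conversely, the
softmax weights turn the second inequality into an equality, and the first loses at most a sum of
pairwise Bhattacharyya coefficients (`integral_gaussMixture_mul_log_le`). Two distinct patterns
differ on some subcarrier; under waterfilling its received variance is bounded below in one pattern
and equals `v` in the other, so each coefficient is `O(√v)`.

Low SNR. Gibbs' inequality against the noise density gives `I ≤ A / v`, with `A` the largest gain
times `P`. Putting all power on the best subcarrier shows that the strongest waterfilled pattern has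
rate at least `log (A / v + 1)`. The quantities of interest lie between these bounds, which are
equivalent as `v → ∞`. -/

lemma fCN_pos {ν : ℝ} (hν : 0 < ν) (t : ℂ) : 0 < fCN ν t := by
  unfold fCN; positivity

lemma log_fCN {ν : ℝ} (hν : 0 < ν) (t : ℂ) :
    Real.log (fCN ν t) = -(‖t‖ ^ 2 / ν + Real.log (Real.pi * ν)) := by
  unfold fCN
  rw [Real.log_div (Real.exp_ne_zero _) (by positivity), Real.log_exp]
  ring

lemma fCN_eq (ν : ℝ) (t : ℂ) :
    fCN ν t = (Real.pi * ν)⁻¹ * Real.exp (-ν⁻¹ * ‖t‖ ^ (2 : ℝ)) := by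
  rw [fCN, Real.rpow_two, div_eq_inv_mul]
  congr 2
  ring

lemma integral_exp_neg_mul_norm_sq {b : ℝ} (hb : 0 < b) :
    ∫ t : ℂ, Real.exp (-b * ‖t‖ ^ (2 : ℝ)) = Real.pi / b := by
  rw [Complex.integral_exp_neg_mul_rpow one_le_two hb]
  norm_num [Real.rpow_neg_one, Real.Gamma_two]
  rfl

lemma integral_fCN {ν : ℝ} (hν : 0 < ν) : ∫ t, fCN ν t = 1 := by
  simp_rw [fCN_eq, integral_const_mul, integral_exp_neg_mul_norm_sq (inv_pos.2 hν)]
  have := Real.pi_pos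
  field_simp

lemma integral_fCN_mul_norm_sq {ν : ℝ} (hν : 0 < ν) : ∫ t, fCN ν t * ‖t‖ ^ 2 = ν := by
  have h := Complex.integral_rpow_mul_exp_neg_mul_rpow (p := 2) (q := 2) one_le_two (by norm_num)
    (inv_pos.2 hν)
  have e : ∀ t : ℂ, fCN ν t * ‖t‖ ^ 2 =
      (Real.pi * ν)⁻¹ * (‖t‖ ^ (2 : ℝ) * Real.exp (-ν⁻¹ * ‖t‖ ^ (2 : ℝ))) := fun t => by
    rw [fCN_eq, ← Real.rpow_two]; ring
  simp_rw [e, integral_const_mul, h]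
  have h2 : (-(2 + 2) / 2 : ℝ) = -(2 : ℕ) := by norm_num
  have h3 : ((2 + 2) / 2 : ℝ) = 2 := by norm_num
  rw [h2, h3, Real.Gamma_two, Real.rpow_neg (inv_nonneg.2 hν.le), Real.rpow_natCast]
  have := Real.pi_pos
  field_simp

lemma sqrt_fCN_mul_fCN {a b : ℝ} (ha : 0 < a) (hb : 0 < b) (t : ℂ) :
    √(fCN a t * fCN b t) =
      (Real.pi * √(a * b))⁻¹ * Real.exp (-((a⁻¹ + b⁻¹) / 2) * ‖t‖ ^ (2 : ℝ)) := by
  have hpi := Real.pi_pos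
  have hs : √(a * b) ^ 2 = a * b := Real.sq_sqrt (by positivity)
  rw [Real.sqrt_eq_iff_mul_self_eq (mul_pos (fCN_pos ha t) (fCN_pos hb t)).le (by positivity),
    fCN_eq, fCN_eq]
  set r := ‖t‖ ^ (2 : ℝ)
  have e : Real.exp (-a⁻¹ * r) * Real.exp (-b⁻¹ * r) =
      Real.exp (-((a⁻¹ + b⁻¹) / 2) * r) * Real.exp (-((a⁻¹ + b⁻¹) / 2) * r) := by
    rw [← Real.exp_add, ← Real.exp_add]; congr 1; ring
  have e2 : (Real.pi * a)⁻¹ * (Real.pi * b)⁻¹ =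
      (Real.pi * √(a * b))⁻¹ * (Real.pi * √(a * b))⁻¹ := by
    rw [← mul_inv, ← mul_inv]; congr 1; linear_combination (-Real.pi ^ 2) * hs
  linear_combination ((Real.pi * a)⁻¹ * (Real.pi * b)⁻¹) * e
    + Real.exp (-((a⁻¹ + b⁻¹) / 2) * r) ^ 2 * e2

/-- The Bhattacharyya coefficient of two centred complex Gaussians. -/
lemma integral_sqrt_fCN_mul_fCN {a b : ℝ} (ha : 0 < a) (hb : 0 < b) :
    ∫ t, √(fCN a t * fCN b t) = 2 * √(a * b) / (a + b) := by
  simp_rw [sqrt_fCN_mul_fCN ha hb, integral_const_mul]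
  rw [integral_exp_neg_mul_norm_sq (by positivity)]
  have hs : √(a * b) ^ 2 = a * b := Real.sq_sqrt (by positivity)
  have hs0 : 0 < √(a * b) := by positivity
  have hpi := Real.pi_pos
  field_simp
  rw [hs]; ring

/-- The density of independent complex Gaussians with variances `c l`. -/
def gaussDensity {N : ℕ} (c : Fin N → ℝ) (y : Fin N → ℂ) : ℝ := ∏ l, fCN (c l) (y l)

section gaussDensity

variable {N : ℕ} {a c : Fin N → ℝ}

lemma gaussDensity_pos (hc : ∀ l, 0 < c l) (y : Fin N → ℂ) : 0 < gaussDensity c y :=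
  Finset.prod_pos fun l _ => fCN_pos (hc l) _

lemma integral_gaussDensity (hc : ∀ l, 0 < c l) : ∫ y, gaussDensity c y = 1 := by
  unfold gaussDensity
  rw [integral_fintype_prod_volume_eq_prod fun l => fCN (c l)]
  simp [fun l => integral_fCN (hc l)]

lemma integrable_gaussDensity (hc : ∀ l, 0 < c l) : Integrable (gaussDensity c) :=
  -- A non-integrable function has Bochner integral `0`, so a nonzero value already proves
  -- integrability.
  .of_integral_ne_zero (by rw [integral_gaussDensity hc]; exact one_ne_zero)

lemma integral_gaussDensity_mul_norm_sq (hc : ∀ l, 0 < c l) (l : Fin N) :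
    ∫ y, gaussDensity c y * ‖y l‖ ^ 2 = c l := by
  -- The moment factor is spread over all coordinates, trivial off `l`, so that the integral
  -- factorizes.
  have e : ∀ y : Fin N → ℂ, gaussDensity c y * ‖y l‖ ^ 2 =
      ∏ m, (fCN (c m) (y m) * if m = l then ‖y m‖ ^ 2 else 1) := fun y => by
    rw [gaussDensity, Finset.prod_mul_distrib]
    simp
  simp_rw [e]
  rw [integral_fintype_prod_volume_eq_prod
      fun m t => fCN (c m) t * if m = l then ‖t‖ ^ 2 else 1,
    Finset.prod_eq_single l]
  · simp [integral_fCN_mul_norm_sq (hc l)]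
  · intro m _ hm
    simp [hm, integral_fCN (hc m)]
  · simp

lemma integrable_gaussDensity_mul_norm_sq (hc : ∀ l, 0 < c l) (l : Fin N) :
    Integrable fun y => gaussDensity c y * ‖y l‖ ^ 2 :=
  .of_integral_ne_zero (by rw [integral_gaussDensity_mul_norm_sq hc l]; exact (hc l).ne')

lemma log_gaussDensity (hc : ∀ l, 0 < c l) (y : Fin N → ℂ) :
    Real.log (gaussDensity c y) = -∑ l, (‖y l‖ ^ 2 / c l + Real.log (Real.pi * c l)) := by
  rw [gaussDensity, Real.log_prod fun l _ => (fCN_pos (hc l) _).ne', ← Finset.sum_neg_distrib]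
  exact Finset.sum_congr rfl fun l _ => log_fCN (hc l) _

lemma gaussDensity_mul_log_gaussDensity (hc : ∀ l, 0 < c l) (y : Fin N → ℂ) :
    gaussDensity a y * Real.log (gaussDensity c y) =
      ∑ l, (-(c l)⁻¹ * (gaussDensity a y * ‖y l‖ ^ 2)
        + -Real.log (Real.pi * c l) * gaussDensity a y) := by
  rw [log_gaussDensity hc, ← Finset.sum_neg_distrib, Finset.mul_sum]
  exact Finset.sum_congr rfl fun l _ => by ring

lemma integrable_gaussDensity_mul_log (ha : ∀ l, 0 < a l) (hc : ∀ l, 0 < c l) :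
    Integrable fun y => gaussDensity a y * Real.log (gaussDensity c y) := by
  simp_rw [gaussDensity_mul_log_gaussDensity hc]
  exact integrable_finsetSum _ fun l _ =>
    ((integrable_gaussDensity_mul_norm_sq ha l).const_mul _).add
      ((integrable_gaussDensity ha).const_mul _)

lemma integral_gaussDensity_mul_log (ha : ∀ l, 0 < a l) (hc : ∀ l, 0 < c l) :
    ∫ y, gaussDensity a y * Real.log (gaussDensity c y) =
      -∑ l, (a l / c l + Real.log (Real.pi * c l)) := by
  simp_rw [gaussDensity_mul_log_gaussDensity hc]
  have h1 : ∀ l, Integrable fun y => -(c l)⁻¹ * (gaussDensity a y * ‖y l‖ ^ 2) := fun l =>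
    (integrable_gaussDensity_mul_norm_sq ha l).const_mul _
  have h2 : ∀ l, Integrable fun y => -Real.log (Real.pi * c l) * gaussDensity a y := fun l =>
    (integrable_gaussDensity ha).const_mul _
  refine (integral_finsetSum _ fun l _ => (h1 l).add (h2 l)).trans ?_
  rw [← Finset.sum_neg_distrib]
  refine Finset.sum_congr rfl fun l _ => ?_
  rw [integral_add' (h1 l) (h2 l), integral_const_mul, integral_const_mul,
    integral_gaussDensity_mul_norm_sq ha, integral_gaussDensity ha]
  ring

lemma sqrt_gaussDensity_mul (ha : ∀ l, 0 < a l) (hc : ∀ l, 0 < c l) (y : Fin N → ℂ) :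
    √(gaussDensity a y * gaussDensity c y) = ∏ l, √(fCN (a l) (y l) * fCN (c l) (y l)) := by
  rw [gaussDensity, gaussDensity, ← Finset.prod_mul_distrib,
    Real.sqrt_prod _ fun l _ => (mul_pos (fCN_pos (ha l) _) (fCN_pos (hc l) _)).le]

lemma integral_sqrt_gaussDensity_mul (ha : ∀ l, 0 < a l) (hc : ∀ l, 0 < c l) :
    ∫ y, √(gaussDensity a y * gaussDensity c y) = ∏ l, (2 * √(a l * c l) / (a l + c l)) := by
  simp_rw [sqrt_gaussDensity_mul ha hc]
  rw [integral_fintype_prod_volume_eq_prod fun l t => √(fCN (a l) t * fCN (c l) t)]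
  exact Finset.prod_congr rfl fun l _ => integral_sqrt_fCN_mul_fCN (ha l) (hc l)

lemma integrable_sqrt_gaussDensity_mul (ha : ∀ l, 0 < a l) (hc : ∀ l, 0 < c l) :
    Integrable fun y => √(gaussDensity a y * gaussDensity c y) := by
  refine .of_integral_ne_zero ?_
  rw [integral_sqrt_gaussDensity_mul ha hc]
  refine (Finset.prod_pos fun l _ => ?_).ne'
  have := ha l
  have := hc l
  positivity

/-- One coordinate with very different variances makes two Gaussians nearly singular. -/
lemma integral_sqrt_gaussDensity_mul_le (ha : ∀ l, 0 < a l) (hc : ∀ l, 0 < c l) (l : Fin N) :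
    ∫ y, √(gaussDensity a y * gaussDensity c y) ≤ 2 * √(c l / a l) := by
  rw [integral_sqrt_gaussDensity_mul ha hc]
  -- By AM-GM every factor is at most `1`, so only the factor at `l` is kept; dropping `c l` from
  -- its denominator then gives the bound.
  have hle : ∀ m, 2 * √(a m * c m) / (a m + c m) ≤ 1 := fun m => by
    have h1 := ha m
    have h2 := hc m
    rw [div_le_one (by positivity), Real.sqrt_mul h1.le]
    nlinarith [sq_nonneg (√(a m) - √(c m)), Real.sq_sqrt h1.le, Real.sq_sqrt h2.le]
  have h0 : ∀ m, 0 ≤ 2 * √(a m * c m) / (a m + c m) := fun m => by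
    have h1 := ha m
    have h2 := hc m
    positivity
  rw [← Finset.mul_prod_erase _ _ (Finset.mem_univ l)]
  refine (mul_le_of_le_one_right (h0 l)
    (Finset.prod_le_one (fun m _ => h0 m) fun m _ => hle m)).trans ?_
  have h1 := ha l
  have h2 := hc l
  have h3 : a l * √(c l / a l) = √(a l * c l) := by
    rw [Real.sqrt_div h2.le, Real.sqrt_mul h1.le]
    have := Real.sqrt_pos.2 h1
    field_simp
    rw [Real.sq_sqrt h1.le]
  rw [div_le_iff₀ (by positivity), ← h3]
  have : 0 ≤ √(c l / a l) := Real.sqrt_nonneg _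
  nlinarith [mul_nonneg this h2.le]

end gaussDensity

/-! ### Gaussian mixtures -/

/-- Each term is at most the total and `log` is monotone; vanishing terms are harmless because they
are multiplied by `0`. -/
lemma sum_mul_log_le {ι : Type*} [Fintype ι] {a : ι → ℝ} (ha : ∀ i, 0 ≤ a i) :
    ∑ i, a i * Real.log (a i) ≤ (∑ i, a i) * Real.log (∑ i, a i) := by
  rw [Finset.sum_mul]
  refine Finset.sum_le_sum fun i _ => ?_
  rcases (ha i).eq_or_lt with h | h
  · simp [← h]
  · exact mul_le_mul_of_nonneg_left (Real.log_le_log h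
      (Finset.single_le_sum (fun j _ => ha j) (Finset.mem_univ i))) h.le

/-- A converse to `sum_mul_log_le` whose error integrates to Bhattacharyya coefficients. From `∑ a j
≤ (∑ √(a j)) ^ 2` and `log (1 + x) ≤ x` one gets `log (∑ a j) ≤ log (a i) + 2 R / √(a i)`, with `R`
the sum of the other square roots; multiplying by `a i` leaves the error `2 √(a i) R`. -/
lemma sum_mul_log_sum_le {ι : Type*} [Fintype ι] [DecidableEq ι] {a : ι → ℝ}
    (ha : ∀ i, 0 < a i) :
    (∑ i, a i) * Real.log (∑ i, a i) ≤
      ∑ i, (a i * Real.log (a i) + 2 * ∑ j ∈ Finset.univ.erase i, √(a i * a j)) := by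
  rw [Finset.sum_mul]
  refine Finset.sum_le_sum fun i _ => ?_
  have hs : ∀ j, 0 < √(a j) := fun j => Real.sqrt_pos.2 (ha j)
  have hsq : ∑ j, a j ≤ (∑ j, √(a j)) ^ 2 := by
    calc ∑ j, a j = ∑ j, √(a j) ^ 2 :=
          Finset.sum_congr rfl fun j _ => (Real.sq_sqrt (ha j).le).symm
      _ ≤ _ := Finset.sum_sq_le_sq_sum_of_nonneg fun j _ => (hs j).le
  have hT : √(a i) + ∑ j ∈ Finset.univ.erase i, √(a j) = ∑ j, √(a j) :=
    Finset.add_sum_erase _ (fun j => √(a j)) (Finset.mem_univ i)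
  set R := ∑ j ∈ Finset.univ.erase i, √(a j) with hR
  have hR0 : 0 ≤ R := Finset.sum_nonneg fun j _ => (hs j).le
  have hsum : 0 < ∑ j, a j := (ha i).trans_le
    (Finset.single_le_sum (fun j _ => (ha j).le) (Finset.mem_univ i))
  have hcross : ∑ j ∈ Finset.univ.erase i, √(a i * a j) = √(a i) * R := by
    rw [hR, Finset.mul_sum]
    exact Finset.sum_congr rfl fun j _ => Real.sqrt_mul (ha i).le _
  have hlog : Real.log (∑ j, a j) ≤ Real.log (a i) + 2 * (R / √(a i)) := by
    have h1 : Real.log (∑ j, a j) ≤ 2 * Real.log (√(a i) + R) := by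
      rw [hT, ← Nat.cast_two, ← Real.log_pow]
      exact Real.log_le_log hsum hsq
    have h2 : √(a i) + R = √(a i) * (1 + R / √(a i)) := by
      have := hs i
      field_simp
    have h3 : Real.log (1 + R / √(a i)) ≤ R / √(a i) := by
      have := Real.log_le_sub_one_of_pos (x := 1 + R / √(a i)) (by have := hs i; positivity)
      linarith
    rw [h2, Real.log_mul (hs i).ne' (by have := hs i; positivity), Real.log_sqrt (ha i).le] at h1
    linarith
  refine (mul_le_mul_of_nonneg_left hlog (ha i).le).trans_eq ?_
  rw [hcross, mul_add]
  congr 1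
  have := hs i
  field_simp
  rw [Real.sq_sqrt (ha i).le, mul_comm]

/-- The density of a mixture of products of centred complex Gaussians. -/
def gaussMixture {ι : Type*} [Fintype ι] {N : ℕ} (p : ι → ℝ) (a : ι → Fin N → ℝ)
    (y : Fin N → ℂ) : ℝ := ∑ i, p i * gaussDensity (a i) y

lemma mul_log_mul_gaussDensity {N : ℕ} {c : Fin N → ℝ} (hc : ∀ l, 0 < c l) (r : ℝ)
    (y : Fin N → ℂ) :
    r * gaussDensity c y * Real.log (r * gaussDensity c y) =
      r * Real.log r * gaussDensity c y +
        r * (gaussDensity c y * Real.log (gaussDensity c y)) := by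
  by_cases h : r = 0
  · simp [h]
  · rw [Real.log_mul h (gaussDensity_pos hc y).ne']
    ring

section gaussMixture

variable {ι : Type*} [Fintype ι] {N : ℕ} {p : ι → ℝ} {a : ι → Fin N → ℝ} {c : Fin N → ℝ}

lemma gaussMixture_pos (hp : p ∈ stdSimplex ℝ ι) (ha : ∀ i l, 0 < a i l) (y : Fin N → ℂ) :
    0 < gaussMixture p a y := by
  have h : ∃ i, 0 < p i := by
    by_contra! h
    have := Finset.sum_nonpos fun i (_ : i ∈ Finset.univ) => h i
    rw [hp.2] at this
    linarith
  obtain ⟨i, hi⟩ := h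
  exact Finset.sum_pos' (fun j _ => mul_nonneg (hp.1 j) (gaussDensity_pos (ha j) y).le)
    ⟨i, Finset.mem_univ i, mul_pos hi (gaussDensity_pos (ha i) y)⟩

lemma integrable_gaussMixture (ha : ∀ i l, 0 < a i l) : Integrable (gaussMixture p a) :=
  integrable_finsetSum _ fun i _ => (integrable_gaussDensity (ha i)).const_mul _

lemma integral_gaussMixture (hp : p ∈ stdSimplex ℝ ι) (ha : ∀ i l, 0 < a i l) :
    ∫ y, gaussMixture p a y = 1 := by
  unfold gaussMixture
  rw [integral_finsetSum _ fun i _ => (integrable_gaussDensity (ha i)).const_mul _]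
  simp_rw [integral_const_mul, integral_gaussDensity (ha _), mul_one]
  exact hp.2

lemma gaussMixture_mul_log_gaussDensity (y : Fin N → ℂ) :
    gaussMixture p a y * Real.log (gaussDensity c y) =
      ∑ i, p i * (gaussDensity (a i) y * Real.log (gaussDensity c y)) := by
  rw [gaussMixture, Finset.sum_mul]
  exact Finset.sum_congr rfl fun i _ => by ring

lemma integrable_gaussMixture_mul_log_gaussDensity (ha : ∀ i l, 0 < a i l)
    (hc : ∀ l, 0 < c l) :
    Integrable fun y => gaussMixture p a y * Real.log (gaussDensity c y) := by
  simp_rw [gaussMixture_mul_log_gaussDensity]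
  exact integrable_finsetSum _ fun i _ => (integrable_gaussDensity_mul_log (ha i) hc).const_mul _

lemma integral_gaussMixture_mul_log_gaussDensity (ha : ∀ i l, 0 < a i l) (hc : ∀ l, 0 < c l) :
    ∫ y, gaussMixture p a y * Real.log (gaussDensity c y) =
      -∑ i, p i * ∑ l, (a i l / c l + Real.log (Real.pi * c l)) := by
  simp_rw [gaussMixture_mul_log_gaussDensity]
  rw [integral_finsetSum _ fun i _ => (integrable_gaussDensity_mul_log (ha i) hc).const_mul _]
  simp_rw [integral_const_mul, integral_gaussDensity_mul_log (ha _) hc]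
  rw [← Finset.sum_neg_distrib]
  exact Finset.sum_congr rfl fun i _ => by ring

/-- The information density of a mixture with fully distinguishable components. -/
def separatedIntegrand (p : ι → ℝ) (a : ι → Fin N → ℝ) (y : Fin N → ℂ) : ℝ :=
  ∑ i, (p i * Real.log (p i) * gaussDensity (a i) y +
    p i * (gaussDensity (a i) y * Real.log (gaussDensity (a i) y)))

lemma integrable_separatedIntegrand (ha : ∀ i l, 0 < a i l) :
    Integrable (separatedIntegrand p a) :=
  integrable_finsetSum _ fun i _ => ((integrable_gaussDensity (ha i)).const_mul _).add
    ((integrable_gaussDensity_mul_log (ha i) (ha i)).const_mul _)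

lemma integral_separatedIntegrand (ha : ∀ i l, 0 < a i l) :
    ∫ y, separatedIntegrand p a y =
      ∑ i, p i * (Real.log (p i) - ∑ l, (1 + Real.log (Real.pi * a i l))) := by
  have h1 : ∀ i, Integrable fun y => p i * Real.log (p i) * gaussDensity (a i) y := fun i =>
    (integrable_gaussDensity (ha i)).const_mul _
  have h2 : ∀ i, Integrable fun y =>
      p i * (gaussDensity (a i) y * Real.log (gaussDensity (a i) y)) := fun i =>
    (integrable_gaussDensity_mul_log (ha i) (ha i)).const_mul _
  refine (integral_finsetSum _ fun i _ => (h1 i).add (h2 i)).trans ?_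
  refine Finset.sum_congr rfl fun i _ => ?_
  rw [integral_add' (h1 i) (h2 i), integral_const_mul, integral_const_mul,
    integral_gaussDensity (ha i), integral_gaussDensity_mul_log (ha i) (ha i)]
  simp_rw [div_self (ha i _).ne']
  ring

lemma separatedIntegrand_le (hp : p ∈ stdSimplex ℝ ι) (ha : ∀ i l, 0 < a i l)
    (y : Fin N → ℂ) :
    separatedIntegrand p a y ≤ gaussMixture p a y * Real.log (gaussMixture p a y) := by
  refine le_trans (Finset.sum_le_sum fun i _ => (mul_log_mul_gaussDensity (ha i) (p i) y).ge) ?_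
  exact sum_mul_log_le fun i => mul_nonneg (hp.1 i) (gaussDensity_pos (ha i) y).le

lemma gaussMixture_mul_log_le (hp : p ∈ stdSimplex ℝ ι) (ha : ∀ i l, 0 < a i l)
    (y : Fin N → ℂ) :
    gaussMixture p a y * Real.log (gaussMixture p a y) ≤
      ∑ i, p i * (gaussDensity (a i) y * Real.log (gaussDensity (a i) y)) :=
  Real.convexOn_mul_log.map_sum_le (fun i _ => hp.1 i) hp.2
    fun i _ => (gaussDensity_pos (ha i) y).le

/-- The integrand is squeezed between the fully separated expression and the convexity bound for `x
log x`, both integrable. -/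
lemma integrable_gaussMixture_mul_log (hp : p ∈ stdSimplex ℝ ι) (ha : ∀ i l, 0 < a i l) :
    Integrable fun y => gaussMixture p a y * Real.log (gaussMixture p a y) := by
  refine integrable_of_le_of_le ?_ (ae_of_all _ (separatedIntegrand_le hp ha))
    (ae_of_all _ (gaussMixture_mul_log_le hp ha)) (integrable_separatedIntegrand ha)
    (integrable_finsetSum _ fun i _ =>
      (integrable_gaussDensity_mul_log (ha i) (ha i)).const_mul _)
  have h := (integrable_gaussMixture (p := p) ha).aestronglyMeasurable
  exact Real.continuous_mul_log.comp_aestronglyMeasurable h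

lemma le_integral_gaussMixture_mul_log (hp : p ∈ stdSimplex ℝ ι) (ha : ∀ i l, 0 < a i l) :
    ∑ i, p i * (Real.log (p i) - ∑ l, (1 + Real.log (Real.pi * a i l))) ≤
      ∫ y, gaussMixture p a y * Real.log (gaussMixture p a y) := by
  rw [← integral_separatedIntegrand ha]
  exact integral_mono (integrable_separatedIntegrand ha) (integrable_gaussMixture_mul_log hp ha)
    (separatedIntegrand_le hp ha)

/-- Nearly singular components make the mixture entropy almost the mean entropy plus the entropy of
`p`: this is `sum_mul_log_sum_le` integrated pointwise. -/
lemma integral_gaussMixture_mul_log_le [DecidableEq ι] (hp : p ∈ stdSimplex ℝ ι)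
    (hp0 : ∀ i, 0 < p i) (ha : ∀ i l, 0 < a i l) :
    ∫ y, gaussMixture p a y * Real.log (gaussMixture p a y) ≤
      ∑ i, p i * (Real.log (p i) - ∑ l, (1 + Real.log (Real.pi * a i l))) +
        ∑ i, 2 * ∑ j ∈ Finset.univ.erase i,
          ∫ y, √(gaussDensity (a i) y * gaussDensity (a j) y) := by
  have hi : ∀ i j, Integrable fun y => √(gaussDensity (a i) y * gaussDensity (a j) y) :=
    fun i j => integrable_sqrt_gaussDensity_mul (ha i) (ha j)
  have hint : Integrable fun y => ∑ i, 2 * ∑ j ∈ Finset.univ.erase i,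
      √(gaussDensity (a i) y * gaussDensity (a j) y) :=
    integrable_finsetSum _ fun i _ => (integrable_finsetSum _ fun j _ => hi i j).const_mul 2
  have hval : ∫ y, ∑ i, 2 * ∑ j ∈ Finset.univ.erase i,
      √(gaussDensity (a i) y * gaussDensity (a j) y) = ∑ i, 2 * ∑ j ∈ Finset.univ.erase i,
        ∫ y, √(gaussDensity (a i) y * gaussDensity (a j) y) := by
    rw [integral_finsetSum _ fun i _ => (integrable_finsetSum _ fun j _ => hi i j).const_mul 2]
    refine Finset.sum_congr rfl fun i _ => ?_
    rw [integral_const_mul, integral_finsetSum _ fun j _ => hi i j]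
  rw [← hval, ← integral_separatedIntegrand ha,
    ← integral_add (integrable_separatedIntegrand ha) hint]
  refine integral_mono (integrable_gaussMixture_mul_log hp ha)
    ((integrable_separatedIntegrand ha).add hint) fun y => ?_
  have hg : ∀ i, 0 < gaussDensity (a i) y := fun i => gaussDensity_pos (ha i) y
  have hp1 : ∀ i, p i ≤ 1 := fun i => hp.2 ▸
    Finset.single_le_sum (fun j _ => hp.1 j) (Finset.mem_univ i)
  refine (sum_mul_log_sum_le fun i => mul_pos (hp0 i) (hg i)).trans ?_
  rw [Finset.sum_add_distrib]
  refine add_le_add (Finset.sum_le_sum fun i _ => (mul_log_mul_gaussDensity (ha i) (p i) y).le)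
    (Finset.sum_le_sum fun i _ => ?_)
  -- Dropping the weights from the cross terms makes the error independent of `p`.
  have hle : ∀ j, p j * gaussDensity (a j) y ≤ gaussDensity (a j) y := fun j =>
    mul_le_of_le_one_left (hg j).le (hp1 j)
  exact mul_le_mul_of_nonneg_left (Finset.sum_le_sum fun j _ => Real.sqrt_le_sqrt
    (mul_le_mul (hle i) (hle j) (mul_pos (hp0 j) (hg j)).le (hg i).le)) two_pos.le

/-- Gibbs' inequality for a Gaussian reference density. -/
lemma integral_mul_log_gaussDensity_le (hp : p ∈ stdSimplex ℝ ι) (ha : ∀ i l, 0 < a i l)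
    (hc : ∀ l, 0 < c l) :
    -∑ i, p i * ∑ l, (a i l / c l + Real.log (Real.pi * c l)) ≤
      ∫ y, gaussMixture p a y * Real.log (gaussMixture p a y) := by
  -- The subtracted difference of densities has integral `0`; including it lets `log x ≤ x - 1` give
  -- the inequality pointwise.
  have h0 : ∫ y, (gaussMixture p a y * Real.log (gaussDensity c y) -
      (gaussDensity c y - gaussMixture p a y)) =
      -∑ i, p i * ∑ l, (a i l / c l + Real.log (Real.pi * c l)) := by
    have e := integral_sub' (integrable_gaussDensity hc) (integrable_gaussMixture (p := p) ha)
    refine (integral_sub (integrable_gaussMixture_mul_log_gaussDensity ha hc)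
      ((integrable_gaussDensity hc).sub (integrable_gaussMixture ha))).trans ?_
    rw [e, integral_gaussDensity hc, integral_gaussMixture hp ha,
      integral_gaussMixture_mul_log_gaussDensity ha hc]
    ring
  rw [← h0]
  refine integral_mono ((integrable_gaussMixture_mul_log_gaussDensity ha hc).sub
    ((integrable_gaussDensity hc).sub (integrable_gaussMixture ha)))
    (integrable_gaussMixture_mul_log hp ha) fun y => ?_
  have hf := gaussMixture_pos hp ha y
  have hq := gaussDensity_pos hc y
  have h := Real.log_le_sub_one_of_pos (div_pos hq hf)
  rw [Real.log_div hq.ne' hf.ne'] at h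
  have h' := mul_le_mul_of_nonneg_left h hf.le
  have e : gaussMixture p a y * (gaussDensity c y / gaussMixture p a y - 1) =
      gaussDensity c y - gaussMixture p a y := by
    field_simp
  show gaussMixture p a y * Real.log (gaussDensity c y) -
      (gaussDensity c y - gaussMixture p a y) ≤ _
  linarith

end gaussMixture

/-! ### Waterfilling -/

section waterfilling

variable {N : ℕ} {g : Fin N → ℝ} {P v : ℝ} {S : Finset (Fin N)} {w : Fin N → ℝ}

lemma IsWaterfilling.nonneg (h : IsWaterfilling g P v S w) {l : Fin N} (hl : l ∈ S) :
    0 ≤ w l := by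
  obtain ⟨c, hc, -⟩ := h
  rw [hc l hl]
  exact le_max_right _ _

lemma waterLevel_pos (hg : ∀ l, 0 < g l) (hP : 0 < P) (hv : 0 < v) {c : ℝ}
    (hc : ∀ l ∈ S, w l = max (c - v / g l) 0) (hs : ∑ l ∈ S, w l = P) : 0 < c := by
  by_contra! h
  refine hP.ne' (hs ▸ Finset.sum_eq_zero fun l hl => ?_)
  rw [hc l hl, max_eq_right]
  have := div_pos hv (hg l)
  linarith

/-- Concavity with Lagrange multiplier `1 / c`. The tangent to the rate at `w l` has slope `1 / (v /
g l + w l)`: exactly `1 / c` where the water reaches, and at most `1 / c` where `w l = 0`, in which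
case `r l - w l ≥ 0`. Summing the tangent bounds uses only the power budget. -/
lemma IsWaterfilling.sum_log_le (hg : ∀ l, 0 < g l) (hP : 0 < P) (hv : 0 < v)
    (h : IsWaterfilling g P v S w) {r : Fin N → ℝ} (hr : ∀ l ∈ S, 0 ≤ r l)
    (hrP : ∑ l ∈ S, r l ≤ P) :
    ∑ l ∈ S, Real.log (g l * r l / v + 1) ≤ ∑ l ∈ S, Real.log (g l * w l / v + 1) := by
  have hw0 : ∀ l ∈ S, 0 ≤ w l := fun l => h.nonneg
  obtain ⟨c, hc, hs⟩ := h
  have hc0 := waterLevel_pos hg hP hv hc hs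
  have key : ∀ l ∈ S, Real.log (g l * r l / v + 1) ≤
      Real.log (g l * w l / v + 1) + (r l - w l) / c := fun l hl => by
    have hgl := hg l
    have hrl := hr l hl
    have hwl := hw0 l hl
    have h1 : 0 < g l * r l / v + 1 := by positivity
    have h2 : 0 < g l * w l / v + 1 := by positivity
    have h3 := Real.log_le_sub_one_of_pos (div_pos h1 h2)
    rw [Real.log_div h1.ne' h2.ne'] at h3
    have h4 : (g l * r l / v + 1) / (g l * w l / v + 1) - 1 = (r l - w l) / (v / g l + w l) := by
      field_simp
      ring
    have h5 : (r l - w l) / (v / g l + w l) ≤ (r l - w l) / c := by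
      rcases le_total (c - v / g l) 0 with hneg | hpos
      · have hw : w l = 0 := by rw [hc l hl, max_eq_right hneg]
        rw [hw]
        exact div_le_div_of_nonneg_left (by linarith) hc0 (by linarith)
      · have hw : w l = c - v / g l := by rw [hc l hl, max_eq_left hpos]
        have : v / g l + w l = c := by rw [hw]; ring
        rw [this]
    linarith
  refine (Finset.sum_le_sum key).trans ?_
  rw [Finset.sum_add_distrib, ← Finset.sum_div, Finset.sum_sub_distrib, hs]
  have : (∑ l ∈ S, r l - P) / c ≤ 0 := div_nonpos_of_nonpos_of_nonneg (by linarith) hc0.le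
  linarith

lemma exists_isWaterfilling (hg : ∀ l, 0 < g l) (hP : 0 < P) (hv : 0 < v) (hS : S.Nonempty) :
    ∃ w : Fin N → ℝ, IsWaterfilling g P v S w := by
  have hvg : ∀ l, 0 < v / g l := fun l => div_pos hv (hg l)
  have hcont : Continuous fun c : ℝ => ∑ l ∈ S, max (c - v / g l) 0 := by fun_prop
  obtain ⟨l, hl⟩ := hS
  have hsum : 0 ≤ ∑ l, v / g l := Finset.sum_nonneg fun l _ => (hvg l).le
  have h0 : ∑ l ∈ S, max (0 - v / g l) 0 = 0 :=
    Finset.sum_eq_zero fun l _ => max_eq_right (by have := hvg l; linarith)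
  -- At this water level a single subcarrier already absorbs power `P`, so the intermediate value
  -- theorem applies.
  have h1 : P ≤ ∑ l ∈ S, max ((P + ∑ m, v / g m) - v / g l) 0 := by
    refine le_trans ?_ (Finset.single_le_sum (fun m _ => le_max_right _ _) hl)
    refine le_trans ?_ (le_max_left _ _)
    have := Finset.single_le_sum (fun m _ => (hvg m).le) (Finset.mem_univ l)
    linarith
  obtain ⟨c, -, hc⟩ := intermediate_value_Icc (a := 0) (b := P + ∑ m, v / g m) (by linarith)
    hcont.continuousOn ⟨h0.le.trans hP.le, h1⟩
  exact ⟨fun l => max (c - v / g l) 0, c, fun _ _ => rfl, hc⟩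

/-- At any noise level, every received power under waterfilling is bounded below. -/
lemma IsWaterfilling.le_gain_mul_add (hg : ∀ l, 0 < g l) (hP : 0 < P) (hv : 0 < v)
    (h : IsWaterfilling g P v S w) {l : Fin N} (hl : l ∈ S) :
    g l * (P / S.card) ≤ g l * w l + v := by
  obtain ⟨c, hc, hs⟩ := h
  have hc0 := waterLevel_pos hg hP hv hc hs
  have hcard : (0 : ℝ) < S.card := by exact_mod_cast Finset.card_pos.2 ⟨l, hl⟩
  -- No power exceeds the water level, so `c ≥ P / S.card`, while `w l + v / g l ≥ c` even on dry
  -- subcarriers.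
  have h1 : P ≤ S.card * c := by
    rw [← hs, ← nsmul_eq_mul]
    refine Finset.sum_le_card_nsmul _ _ _ fun m hm => ?_
    rw [hc m hm]
    exact max_le (by have := div_pos hv (hg m); linarith) hc0.le
  have h2 : P / S.card ≤ c := by rw [div_le_iff₀ hcard]; linarith
  have h3 : c - v / g l ≤ w l := hc l hl ▸ le_max_left _ _
  have h4 : P / S.card ≤ w l + v / g l := by linarith
  refine (mul_le_mul_of_nonneg_left h4 (hg l).le).trans_eq ?_
  have := hg l
  field_simp

/-- A set of the largest gains dominates any set of the same size, under waterfilling in each. -/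
lemma IsWaterfilling.sum_log_le_of_largest (hg : ∀ l, 0 < g l) (hP : 0 < P) (hv : 0 < v)
    {T : Finset (Fin N)} {w' : Fin N → ℝ} (h : IsWaterfilling g P v S w)
    (h' : IsWaterfilling g P v T w') (hcard : S.card = T.card)
    (hS : ∀ l ∈ S, ∀ m ∉ S, g m ≤ g l) :
    ∑ l ∈ T, Real.log (g l * w' l / v + 1) ≤ ∑ l ∈ S, Real.log (g l * w l / v + 1) := by
  classical
  -- A bijection from `S` to `T` fixing the common elements. Then `e x` is either `x` itself or
  -- outside `S`, so it never has a larger gain than `x`.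
  obtain ⟨e, he⟩ := Finset.exists_equiv_extend_of_card_eq (α := S) (t := T)
    (s := Finset.univ.filter fun x => x.1 ∈ T) (f := Subtype.val) (by simpa using hcard)
    (by intro y; simp; tauto) Subtype.val_injective.injOn
  have hge : ∀ x : S, g (e x) ≤ g x := fun x => by
    by_cases hx : (e x : Fin N) ∈ S
    · have h1 := he ⟨e x, hx⟩ (by simp)
      have h2 : (⟨e x, hx⟩ : S) = x := e.injective (Subtype.ext h1)
      exact (congrArg (fun z : S => g z) h2).le
    · exact hS x x.2 _ hx
  -- The powers of `T` are carried back to `S`, where they meet gains at least as large;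
  -- waterfilling on `S` does no worse than this competitor.
  set r : Fin N → ℝ := fun l => if hl : l ∈ S then w' (e ⟨l, hl⟩) else 0 with hr
  have hrx : ∀ x : S, r x = w' (e x) := fun x => by simp [hr]
  have hw' : ∀ x : S, 0 ≤ w' (e x) := fun x => h'.nonneg (e x).2
  have hsum : ∀ F : Fin N → ℝ, ∑ l ∈ T, F l = ∑ x : S, F (e x) := fun F => by
    rw [← Finset.sum_coe_sort, Equiv.sum_comp e fun y : T => F y]
  refine le_trans ?_ (h.sum_log_le hg hP hv (r := r) ?_ ?_)
  · rw [hsum, ← Finset.sum_coe_sort S]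
    refine Finset.sum_le_sum fun x _ => ?_
    rw [hrx]
    have h1 := hg (e x)
    have h2 := hw' x
    have h3 := hge x
    refine Real.log_le_log (by positivity) ?_
    gcongr
  · intro l hl
    rw [hrx ⟨l, hl⟩]
    exact hw' _
  · obtain ⟨c, -, hs⟩ := h'
    rw [← Finset.sum_coe_sort S]
    simp_rw [hrx]
    rw [← hsum, hs]

end waterfilling

/-! ### Mutual information bounds -/

/-- Variances of the received components, given that pattern `i` is used. -/
def receivedVar {N K : ℕ} (g : Fin N → ℝ) (ρ : SAP N K → Fin N → ℝ) (v : ℝ) (i : SAP N K)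
    (l : Fin N) : ℝ := if l ∈ i.1 then g l * ρ i l + v else v

section mutualInfo

variable {N K : ℕ} {g : Fin N → ℝ} {P v : ℝ} {p : SAP N K → ℝ} {ρ : SAP N K → Fin N → ℝ}

lemma receivedVar_pos (hg : ∀ l, 0 < g l) (hv : 0 < v) (hρ : FeasiblePowers P ρ) (i : SAP N K)
    (l : Fin N) : 0 < receivedVar g ρ v i l := by
  unfold receivedVar
  split_ifs with h
  · exact add_pos_of_nonneg_of_pos (mul_nonneg (hg l).le ((hρ i).1 l h)) hv
  · exact hv

lemma densityYGiven_eq (i : SAP N K) (y : Fin N → ℂ) :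
    densityYGiven g ρ v i y = gaussDensity (receivedVar g ρ v i) y := by
  rw [densityYGiven, gaussDensity, ← Finset.prod_mul_prod_compl i.1]
  congr 1
  · exact Finset.prod_congr rfl fun l hl => by rw [receivedVar, if_pos hl]
  · exact Finset.prod_congr rfl fun l hl => by rw [receivedVar, if_neg (Finset.mem_compl.1 hl)]

lemma densityY_eq : densityY g p ρ v = gaussMixture p (receivedVar g ρ v) := by
  ext y
  simp_rw [densityY, gaussMixture, densityYGiven_eq]

lemma diffEntropy_gaussDensity {c : Fin N → ℝ} (hc : ∀ l, 0 < c l) :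
    diffEntropy (gaussDensity c) = ∑ l, (1 + Real.log (Real.pi * c l)) := by
  rw [diffEntropy, integral_gaussDensity_mul_log hc hc, neg_neg]
  simp_rw [div_self (hc _).ne']

lemma diffEntropy_densityZ (hv : 0 < v) :
    diffEntropy (densityZ N v) = ∑ _l : Fin N, (1 + Real.log (Real.pi * v)) :=
  diffEntropy_gaussDensity (c := fun _ => v) fun _ => hv

lemma sum_log_receivedVar (hg : ∀ l, 0 < g l) (hv : 0 < v) (hρ : FeasiblePowers P ρ)
    (i : SAP N K) :
    ∑ l, (1 + Real.log (Real.pi * receivedVar g ρ v i l)) =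
      diffEntropy (densityZ N v) + patternRate g ρ v i := by
  have e : patternRate g ρ v i =
      ∑ l, if l ∈ i.1 then Real.log (g l * ρ i l / v + 1) else 0 := by
    simp [patternRate, Finset.sum_ite_mem]
  rw [diffEntropy_densityZ hv, e, ← Finset.sum_add_distrib]
  refine Finset.sum_congr rfl fun l _ => ?_
  unfold receivedVar
  split_ifs with h
  · have h1 : 0 ≤ g l * ρ i l := mul_nonneg (hg l).le ((hρ i).1 l h)
    have h2 : Real.pi * (g l * ρ i l + v) = (Real.pi * v) * (g l * ρ i l / v + 1) := by
      field_simp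
    have := Real.pi_pos
    rw [h2, Real.log_mul (by positivity) (by positivity), add_assoc]
  · rw [add_zero]

lemma sum_mul_sub_entropy_add (hg : ∀ l, 0 < g l) (hv : 0 < v) (hp : p ∈ stdSimplex ℝ (SAP N K))
    (hρ : FeasiblePowers P ρ) :
    ∑ i, p i * (Real.log (p i) - ∑ l, (1 + Real.log (Real.pi * receivedVar g ρ v i l))) =
      -∑ i, p i * (patternRate g ρ v i - Real.log (p i)) - diffEntropy (densityZ N v) := by
  have h : diffEntropy (densityZ N v) = ∑ i, p i * diffEntropy (densityZ N v) := by
    rw [← Finset.sum_mul, hp.2, one_mul]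
  rw [h, ← Finset.sum_neg_distrib, ← Finset.sum_sub_distrib]
  refine Finset.sum_congr rfl fun i _ => ?_
  rw [sum_log_receivedVar hg hv hρ]
  ring

/-- The choice of pattern conveys at most its own entropy on top of the mean rate. -/
lemma mutualInfo_le_sum (hg : ∀ l, 0 < g l) (hv : 0 < v) (hp : p ∈ stdSimplex ℝ (SAP N K))
    (hρ : FeasiblePowers P ρ) :
    mutualInfo g p ρ v ≤ ∑ i, p i * (patternRate g ρ v i - Real.log (p i)) := by
  have h := le_integral_gaussMixture_mul_log hp (receivedVar_pos hg hv hρ)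
  rw [sum_mul_sub_entropy_add hg hv hp hρ] at h
  rw [mutualInfo, diffEntropy, densityY_eq]
  linarith

lemma sum_le_mutualInfo_add (hg : ∀ l, 0 < g l) (hv : 0 < v) (hp : p ∈ stdSimplex ℝ (SAP N K))
    (hp0 : ∀ i, 0 < p i) (hρ : FeasiblePowers P ρ) :
    ∑ i, p i * (patternRate g ρ v i - Real.log (p i)) ≤
      mutualInfo g p ρ v + ∑ i : SAP N K, 2 * ∑ j ∈ Finset.univ.erase i,
        ∫ y, √(gaussDensity (receivedVar g ρ v i) y * gaussDensity (receivedVar g ρ v j) y) := by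
  have h := integral_gaussMixture_mul_log_le hp hp0 (receivedVar_pos hg hv hρ)
  rw [sum_mul_sub_entropy_add hg hv hp hρ] at h
  rw [mutualInfo, diffEntropy, densityY_eq]
  linarith

lemma mutualInfo_single (hg : ∀ l, 0 < g l) (hv : 0 < v) (hρ : FeasiblePowers P ρ)
    (i : SAP N K) : mutualInfo g (Pi.single i 1) ρ v = patternRate g ρ v i := by
  have h : densityY g (Pi.single i 1) ρ v = gaussDensity (receivedVar g ρ v i) := by
    ext y
    rw [densityY, Finset.sum_eq_single i]
    · rw [Pi.single_eq_same, one_mul, densityYGiven_eq]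
    · intro j _ hj
      rw [Pi.single_eq_of_ne hj, zero_mul]
    · simp
  rw [mutualInfo, h, diffEntropy_gaussDensity (receivedVar_pos hg hv hρ i),
    sum_log_receivedVar hg hv hρ]
  ring

/-- Gibbs' inequality with the noise density as reference. At low SNR this replaces the log-sum-exp
bound, which does not vanish when there are several patterns: it tends to the logarithm of their
number. -/
lemma mutualInfo_le_received_power (hg : ∀ l, 0 < g l) (hv : 0 < v)
    (hp : p ∈ stdSimplex ℝ (SAP N K)) (hρ : FeasiblePowers P ρ) :
    mutualInfo g p ρ v ≤ ∑ i, p i * ∑ l ∈ i.1, g l * ρ i l / v := by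
  have h := integral_mul_log_gaussDensity_le (c := fun _ => v) hp (receivedVar_pos hg hv hρ)
    fun _ => hv
  have e : ∀ i : SAP N K, ∑ l, (receivedVar g ρ v i l / v + Real.log (Real.pi * v)) =
      diffEntropy (densityZ N v) + ∑ l ∈ i.1, g l * ρ i l / v := fun i => by
    have e' : ∑ l ∈ i.1, g l * ρ i l / v = ∑ l, if l ∈ i.1 then g l * ρ i l / v else 0 := by
      simp [Finset.sum_ite_mem]
    rw [diffEntropy_densityZ hv, e', ← Finset.sum_add_distrib]
    refine Finset.sum_congr rfl fun l _ => ?_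
    unfold receivedVar
    split_ifs
    · field_simp
      ring
    · rw [div_self hv.ne', add_zero]
  simp_rw [e, mul_add, Finset.sum_add_distrib, ← Finset.sum_mul] at h
  rw [hp.2] at h
  rw [mutualInfo, diffEntropy, densityY_eq]
  linarith

lemma mutualInfo_le_of_gain_le (hg : ∀ l, 0 < g l) (hv : 0 < v)
    (hp : p ∈ stdSimplex ℝ (SAP N K)) (hρ : FeasiblePowers P ρ) {G : ℝ} (hG0 : 0 ≤ G)
    (hG : ∀ l, g l ≤ G) : mutualInfo g p ρ v ≤ G * P / v := by
  refine (mutualInfo_le_received_power hg hv hp hρ).trans ?_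
  calc ∑ i, p i * ∑ l ∈ i.1, g l * ρ i l / v ≤ ∑ i, p i * (G * P / v) := by
        refine Finset.sum_le_sum fun i _ => mul_le_mul_of_nonneg_left ?_ (hp.1 i)
        rw [← Finset.sum_div]
        refine div_le_div_of_nonneg_right ?_ hv.le
        refine le_trans (Finset.sum_le_sum fun l hl =>
          mul_le_mul_of_nonneg_right (hG l) ((hρ i).1 l hl)) ?_
        rw [← Finset.mul_sum]
        exact mul_le_mul_of_nonneg_left (hρ i).2 hG0
    _ = G * P / v := by rw [← Finset.sum_mul, hp.2, one_mul]

/-! ### The log-sum-exp of the pattern rates -/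

lemma prod_eq_exp_patternRate (hg : ∀ l, 0 < g l) (hv : 0 < v) (hρ : FeasiblePowers P ρ)
    (i : SAP N K) : ∏ l ∈ i.1, (g l * ρ i l / v + 1) = Real.exp (patternRate g ρ v i) := by
  rw [patternRate, Real.exp_sum]
  refine Finset.prod_congr rfl fun l hl => (Real.exp_log ?_).symm
  have := mul_nonneg (hg l).le ((hρ i).1 l hl)
  positivity

lemma highSNRInfo_eq (hg : ∀ l, 0 < g l) (hv : 0 < v) (hρ : FeasiblePowers P ρ) :
    highSNRInfo g ρ v = Real.log (∑ i, Real.exp (patternRate g ρ v i)) := by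
  simp_rw [highSNRInfo, prod_eq_exp_patternRate hg hv hρ]

/-- Gibbs variational principle: nonnegativity of the relative entropy of `p` to the softmax weights
`exp (R i - L)`, obtained termwise from `x + 1 ≤ exp x`. -/
lemma sum_mul_sub_log_le_log_sum_exp {ι : Type*} [Fintype ι] {p : ι → ℝ}
    (hp : p ∈ stdSimplex ℝ ι) (R : ι → ℝ) :
    ∑ i, p i * (R i - Real.log (p i)) ≤ Real.log (∑ i, Real.exp (R i)) := by
  have hne : (Finset.univ : Finset ι).Nonempty := by
    by_contra h
    have h2 := hp.2
    rw [Finset.not_nonempty_iff_eq_empty.1 h, Finset.sum_empty] at h2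
    exact zero_ne_one h2
  have hS : 0 < ∑ i, Real.exp (R i) := Finset.sum_pos (fun i _ => Real.exp_pos _) hne
  set L := Real.log (∑ i, Real.exp (R i)) with hL
  have key : ∀ i, p i * (R i - Real.log (p i)) ≤ p i * L + (Real.exp (R i - L) - p i) :=
    fun i => by
      rcases (hp.1 i).eq_or_lt with h | h
      · rw [← h]
        have := Real.exp_pos (R i - L)
        simp only [zero_mul, sub_zero, zero_add]
        exact this.le
      · have h1 := Real.add_one_le_exp (R i - L - Real.log (p i))
        rw [Real.exp_sub _ (Real.log _), Real.exp_log h, le_div_iff₀ h] at h1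
        nlinarith
  refine (Finset.sum_le_sum fun i _ => key i).trans ?_
  rw [Finset.sum_add_distrib, ← Finset.sum_mul, Finset.sum_sub_distrib, hp.2]
  simp_rw [Real.exp_sub]
  rw [← Finset.sum_div, hL, Real.exp_log hS, div_self hS.ne']
  linarith

/-- For softmax weights `R i - log (p i)` does not depend on `i`. Their strict positivity is what
the lower bound on the mutual information requires. -/
lemma exists_sum_mul_sub_log_eq {ι : Type*} [Fintype ι] [Nonempty ι] (R : ι → ℝ) :
    ∃ p ∈ stdSimplex ℝ ι, (∀ i, 0 < p i) ∧
      ∑ i, p i * (R i - Real.log (p i)) = Real.log (∑ i, Real.exp (R i)) := by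
  have hS : 0 < ∑ i, Real.exp (R i) :=
    Finset.sum_pos (fun i _ => Real.exp_pos _) Finset.univ_nonempty
  have hsum : ∑ i, Real.exp (R i - Real.log (∑ i, Real.exp (R i))) = 1 := by
    simp_rw [Real.exp_sub, Real.exp_log hS]
    rw [← Finset.sum_div, div_self hS.ne']
  refine ⟨fun i => Real.exp (R i - Real.log (∑ i, Real.exp (R i))),
    ⟨fun i => (Real.exp_pos _).le, hsum⟩, fun i => Real.exp_pos _, ?_⟩
  simp_rw [Real.log_exp, sub_sub_cancel]
  rw [← Finset.sum_mul, hsum, one_mul]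

lemma mutualInfo_le_highSNRInfo (hg : ∀ l, 0 < g l) (hv : 0 < v)
    (hp : p ∈ stdSimplex ℝ (SAP N K)) (hρ : FeasiblePowers P ρ) :
    mutualInfo g p ρ v ≤ highSNRInfo g ρ v := by
  rw [highSNRInfo_eq hg hv hρ]
  exact (mutualInfo_le_sum hg hv hp hρ).trans (sum_mul_sub_log_le_log_sum_exp hp _)

/-! ### Waterfilling within each pattern -/

variable {w : SAP N K → Fin N → ℝ}

lemma feasiblePowers_of_isWaterfilling (hw : ∀ i, IsWaterfilling g P v i.1 (w i)) :
    FeasiblePowers P w := fun i =>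
  ⟨fun _ hl => (hw i).nonneg hl, let ⟨_, _, h⟩ := hw i; h.le⟩

lemma patternRate_le_waterfilling (hg : ∀ l, 0 < g l) (hP : 0 < P) (hv : 0 < v)
    (hw : ∀ i, IsWaterfilling g P v i.1 (w i)) (hρ : FeasiblePowers P ρ) (i : SAP N K) :
    patternRate g ρ v i ≤ patternRate g w v i :=
  (hw i).sum_log_le hg hP hv (hρ i).1 (hρ i).2

lemma highSNRInfo_le_waterfilling [Nonempty (SAP N K)] (hg : ∀ l, 0 < g l) (hP : 0 < P)
    (hv : 0 < v) (hw : ∀ i, IsWaterfilling g P v i.1 (w i)) (hρ : FeasiblePowers P ρ) :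
    highSNRInfo g ρ v ≤ highSNRInfo g w v := by
  rw [highSNRInfo_eq hg hv hρ, highSNRInfo_eq hg hv (feasiblePowers_of_isWaterfilling hw)]
  exact Real.log_le_log (Finset.sum_pos (fun i _ => Real.exp_pos _) Finset.univ_nonempty)
    (Finset.sum_le_sum fun i _ =>
      Real.exp_le_exp.2 (patternRate_le_waterfilling hg hP hv hw hρ i))

/-- Distinct patterns have equal size, so some `l` is active in `i` only. There the variance is at
least `G * (P / K)` under `i` and exactly `v` under `j`. -/
lemma integral_sqrt_receivedVar_le (hg : ∀ l, 0 < g l) (hP : 0 < P) (hv : 0 < v)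
    (hw : ∀ i, IsWaterfilling g P v i.1 (w i)) {G : ℝ} (hG0 : 0 < G) (hG : ∀ l, G ≤ g l)
    {i j : SAP N K} (hij : j ≠ i) :
    ∫ y, √(gaussDensity (receivedVar g w v i) y * gaussDensity (receivedVar g w v j) y) ≤
      2 * √(v / (G * (P / K))) := by
  have hpos := receivedVar_pos hg hv (feasiblePowers_of_isWaterfilling hw)
  obtain ⟨l, hli, hlj⟩ : ∃ l ∈ i.1, l ∉ j.1 := by
    by_contra! h
    exact hij (Subtype.ext (Finset.eq_of_subset_of_card_le h (by rw [i.2, j.2])).symm)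
  refine (integral_sqrt_gaussDensity_mul_le (hpos i) (hpos j) l).trans ?_
  have hK : (0 : ℝ) < K := by exact_mod_cast i.2 ▸ Finset.card_pos.2 ⟨l, hli⟩
  have h1 := (hw i).le_gain_mul_add hg hP hv hli
  rw [i.2] at h1
  have h2 : G * (P / K) ≤ g l * w i l + v :=
    (mul_le_mul_of_nonneg_right (hG l) (by positivity)).trans h1
  rw [receivedVar, receivedVar, if_neg hlj, if_pos hli]
  gcongr

lemma highSNRInfo_le_mutualInfo_add [Nonempty (SAP N K)] (hg : ∀ l, 0 < g l) (hP : 0 < P)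
    (hv : 0 < v) (hw : ∀ i, IsWaterfilling g P v i.1 (w i)) {G : ℝ} (hG0 : 0 < G)
    (hG : ∀ l, G ≤ g l) :
    ∃ p ∈ stdSimplex ℝ (SAP N K), highSNRInfo g w v ≤ mutualInfo g p w v +
      ∑ i : SAP N K, 2 * ∑ _j ∈ Finset.univ.erase i, 2 * √(v / (G * (P / K))) := by
  have hf := feasiblePowers_of_isWaterfilling hw
  obtain ⟨p, hp, hp0, hpL⟩ := exists_sum_mul_sub_log_eq (patternRate g w v)
  refine ⟨p, hp, ?_⟩
  rw [highSNRInfo_eq hg hv hf, ← hpL]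
  refine (sum_le_mutualInfo_add hg hv hp hp0 hf).trans ?_
  gcongr with i _ j hj
  exact integral_sqrt_receivedVar_le hg hP hv hw hG0 hG (Finset.ne_of_mem_erase hj)

/-- Waterfilling beats the competitor that spends all the power on subcarrier `m`. -/
lemma log_le_patternRate_waterfilling (hg : ∀ l, 0 < g l) (hP : 0 < P) (hv : 0 < v)
    (hw : ∀ i, IsWaterfilling g P v i.1 (w i)) {m : Fin N} {i : SAP N K} (hm : m ∈ i.1) :
    Real.log (g m * P / v + 1) ≤ patternRate g w v i := by
  refine le_trans ?_ ((hw i).sum_log_le hg hP hv (r := Pi.single m P) ?_ ?_)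
  · rw [Finset.sum_eq_single_of_mem m hm]
    · rw [Pi.single_eq_same]
    · intro l _ hl
      simp [Pi.single_eq_of_ne hl]
  · intro l _
    exact (Pi.single_nonneg.2 hP.le : (0 : Fin N → ℝ) ≤ Pi.single m P) l
  · rw [Finset.sum_pi_single', if_pos hm]

end mutualInfo

/-! ### Optimal values as suprema, and the low-SNR squeeze -/

section optimum

variable {N K : ℕ} {g : Fin N → ℝ} {P v : ℝ} {ρ : SAP N K → Fin N → ℝ}

lemma single_mem_stdSimplex_SAP (i : SAP N K) :
    (Pi.single i 1 : SAP N K → ℝ) ∈ stdSimplex ℝ (SAP N K) := single_mem_stdSimplex ℝ i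

lemma bddAbove_feasibleValues (hg : ∀ l, 0 < g l) (hv : 0 < v) :
    BddAbove (feasibleValues K g P v) := by
  refine ⟨(∑ l, g l) * P / v, ?_⟩
  rintro x ⟨p, hp, ρ, hρ, rfl⟩
  exact mutualInfo_le_of_gain_le hg hv hp hρ (Finset.sum_nonneg fun l _ => (hg l).le)
    fun l => Finset.single_le_sum (fun m _ => (hg m).le) (Finset.mem_univ l)

lemma feasibleValues_nonempty [Nonempty (SAP N K)] (hP : 0 < P) :
    (feasibleValues K g P v).Nonempty :=
  let ⟨i⟩ := ‹Nonempty (SAP N K)›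
  ⟨_, Pi.single i 1, single_mem_stdSimplex_SAP i, 0, fun _ => ⟨fun _ _ => le_rfl, by simp [hP.le]⟩,
    rfl⟩

lemma valuesGivenPowers_subset (hρ : FeasiblePowers P ρ) :
    valuesGivenPowers g ρ v ⊆ feasibleValues K g P v := by
  rintro x ⟨p, hp, rfl⟩
  exact ⟨p, hp, ρ, hρ, rfl⟩

lemma mutualInfo_le_optMutualInfoGivenPowers (hg : ∀ l, 0 < g l) (hv : 0 < v)
    (hρ : FeasiblePowers P ρ) {p : SAP N K → ℝ} (hp : p ∈ stdSimplex ℝ (SAP N K)) :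
    mutualInfo g p ρ v ≤ optMutualInfoGivenPowers g ρ v :=
  le_csSup ((bddAbove_feasibleValues hg hv).mono (valuesGivenPowers_subset hρ)) ⟨p, hp, rfl⟩

lemma optMutualInfoGivenPowers_le_optMutualInfo [Nonempty (SAP N K)] (hg : ∀ l, 0 < g l)
    (hv : 0 < v) (hρ : FeasiblePowers P ρ) :
    optMutualInfoGivenPowers g ρ v ≤ optMutualInfo K g P v :=
  let ⟨i⟩ := ‹Nonempty (SAP N K)›
  csSup_le_csSup (bddAbove_feasibleValues hg hv) ⟨_, _, single_mem_stdSimplex_SAP i, rfl⟩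
    (valuesGivenPowers_subset hρ)

lemma optMutualInfo_le [Nonempty (SAP N K)] (hP : 0 < P) {B : ℝ}
    (h : ∀ p ∈ stdSimplex ℝ (SAP N K), ∀ ρ : SAP N K → Fin N → ℝ, FeasiblePowers P ρ →
      mutualInfo g p ρ v ≤ B) : optMutualInfo K g P v ≤ B := by
  refine csSup_le (feasibleValues_nonempty hP) ?_
  rintro x ⟨p, hp, ρ, hρ, rfl⟩
  exact h p hp ρ hρ

/-- From `log (A / v + 1) ≥ A / (v + A)` the ratio `u / t` lies between `v / (v + A)` and `1`. The
same bound makes `u` and `t` positive, so the division is legitimate. -/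
lemma isEquivalent_of_log_le_of_le {u t : ℝ → ℝ} {A : ℝ} (hA : 0 < A)
    (h : ∀ v, 0 < v → Real.log (A / v + 1) ≤ u v ∧ u v ≤ t v ∧ t v ≤ A / v) :
    Asymptotics.IsEquivalent atTop u t := by
  have hlog : ∀ v, 0 < v → A / (v + A) ≤ Real.log (A / v + 1) := fun v hv => by
    have := Real.one_sub_inv_le_log_of_pos (x := A / v + 1) (by positivity)
    refine le_trans (le_of_eq ?_) this
    field_simp
    ring
  have hupos : ∀ v, 0 < v → 0 < u v := fun v hv =>
    (by positivity : 0 < A / (v + A)).trans_le ((hlog v hv).trans (h v hv).1)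
  have htpos : ∀ v, 0 < v → 0 < t v := fun v hv => (hupos v hv).trans_le (h v hv).2.1
  refine (Asymptotics.isEquivalent_iff_tendsto_one ?_).2 ?_
  · filter_upwards [eventually_gt_atTop 0] with v hv using (htpos v hv).ne'
  have hlim : Tendsto (fun v : ℝ => 1 - A / (v + A)) atTop (𝓝 1) := by
    have := (tendsto_const_nhds (x := A)).div_atTop (tendsto_atTop_add_const_right atTop A tendsto_id)
    simpa using this.const_sub 1
  refine tendsto_of_tendsto_of_tendsto_of_le_of_le' hlim tendsto_const_nhds ?_ ?_
  · filter_upwards [eventually_gt_atTop 0] with v hv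
    obtain ⟨h1, h2, h3⟩ := h v hv
    rw [Pi.div_apply, le_div_iff₀ (htpos v hv)]
    have h4 : 1 - A / (v + A) = v / (v + A) := by
      field_simp
      ring
    rw [h4]
    calc v / (v + A) * t v ≤ v / (v + A) * (A / v) := by gcongr
      _ = A / (v + A) := by field_simp
      _ ≤ u v := (hlog v hv).trans h1
  · filter_upwards [eventually_gt_atTop 0] with v hv
    exact div_le_one_of_le₀ (h v hv).2.1 (htpos v hv).le

end optimum
end

theorem proposition8 {N K : ℕ} (hK : 1 ≤ K) (hKN : K ≤ N)
    (g : Fin N → ℝ) (hg : ∀ l, 0 < g l) (P : ℝ) (hP : 0 < P) :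
    -- well-posedness: the entropies are finite, the optimal values are finite suprema, and
    -- waterfilling allocations exist
    (∀ v : ℝ, 0 < v →
      (∀ p ∈ stdSimplex ℝ (SAP N K), ∀ ρ : SAP N K → Fin N → ℝ, FeasiblePowers P ρ →
        Integrable (fun y => densityY g p ρ v y * Real.log (densityY g p ρ v y))) ∧
      (feasibleValues K g P v).Nonempty ∧ BddAbove (feasibleValues K g P v) ∧
      ∀ i : SAP N K, ∃ w : Fin N → ℝ, IsWaterfilling g P v i.1 w) ∧
    ∀ w : ℝ → SAP N K → Fin N → ℝ,
      (∀ v : ℝ, 0 < v → ∀ i : SAP N K, IsWaterfilling g P v i.1 (w v i)) →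
      -- waterfilling is feasible
      (∀ v : ℝ, 0 < v → FeasiblePowers P (w v)) ∧
      -- high SNR
      ((∀ v : ℝ, 0 < v → ∀ ρ : SAP N K → Fin N → ℝ, FeasiblePowers P ρ →
          highSNRInfo g ρ v ≤ highSNRInfo g (w v) v) ∧
        Tendsto (fun v => optMutualInfo K g P v - optMutualInfoGivenPowers g (w v) v)
          (𝓝[>] 0) (𝓝 0)) ∧
      -- low SNR
      ((∀ v : ℝ, 0 < v → ∀ i : SAP N K,
          (∀ l ∈ i.1, ∀ m ∉ i.1, g m ≤ g l) → IsStrongestPattern g (w v) v i) ∧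
        Asymptotics.IsEquivalent atTop
          (fun v => optMutualInfoGivenPowers g (w v) v) (fun v => optMutualInfo K g P v) ∧
        ∀ s : ℝ → SAP N K, (∀ v : ℝ, 0 < v → IsStrongestPattern g (w v) v (s v)) →
          (∀ v : ℝ, 0 < v → ∀ ρ : SAP N K → Fin N → ℝ, FeasiblePowers P ρ → ∀ j : SAP N K,
            patternRate g ρ v j ≤ patternRate g (w v) v (s v)) ∧
          Asymptotics.IsEquivalent atTop
            (fun v => mutualInfo g (Pi.single (s v) 1) (w v) v)
            (fun v => optMutualInfo K g P v)) := by
  have : Nonempty (Fin N) := ⟨⟨0, by omega⟩⟩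
  obtain ⟨m, hm⟩ := Finite.exists_max g
  obtain ⟨m', hm'⟩ := Finite.exists_min g
  -- For the low-SNR lower bound any pattern containing one best subcarrier `m` suffices.
  obtain ⟨S, hmS, -, hScard⟩ := Finset.exists_subsuperset_card_eq (n := K)
    (Finset.subset_univ {m}) (by simpa using hK) (by simpa using hKN)
  let i₀ : SAP N K := ⟨S, hScard⟩
  have hmi₀ : m ∈ i₀.1 := hmS (Finset.mem_singleton_self m)
  have : Nonempty (SAP N K) := ⟨i₀⟩
  refine ⟨fun v hv => ⟨fun p hp ρ hρ => ?_, feasibleValues_nonempty hP,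
    bddAbove_feasibleValues hg hv, fun i => exists_isWaterfilling hg hP hv ?_⟩,
    fun w hw => ?_⟩
  · rw [densityY_eq]
    exact integrable_gaussMixture_mul_log hp (receivedVar_pos hg hv hρ)
  · rw [← Finset.card_pos, i.2]
    exact hK
  have hf : ∀ v : ℝ, 0 < v → FeasiblePowers P (w v) := fun v hv =>
    feasiblePowers_of_isWaterfilling (hw v hv)
  have hlow : ∀ v : ℝ, 0 < v → Real.log (g m * P / v + 1) ≤ patternRate g (w v) v i₀ :=
    fun v hv => log_le_patternRate_waterfilling hg hP hv (hw v hv) hmi₀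
  have hsingle : ∀ v : ℝ, 0 < v → ∀ i,
      patternRate g (w v) v i ≤ optMutualInfoGivenPowers g (w v) v := fun v hv i => by
    rw [← mutualInfo_single hg hv (hf v hv) i]
    exact mutualInfo_le_optMutualInfoGivenPowers hg hv (hf v hv) (single_mem_stdSimplex_SAP i)
  have hle : ∀ v : ℝ, 0 < v →
      optMutualInfoGivenPowers g (w v) v ≤ optMutualInfo K g P v := fun v hv =>
    optMutualInfoGivenPowers_le_optMutualInfo hg hv (hf v hv)
  have hup : ∀ v : ℝ, 0 < v → optMutualInfo K g P v ≤ g m * P / v := fun v hv =>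
    optMutualInfo_le hP fun p hp ρ hρ => mutualInfo_le_of_gain_le hg hv hp hρ (hg m).le hm
  refine ⟨hf, ⟨fun v hv ρ hρ => highSNRInfo_le_waterfilling hg hP hv (hw v hv) hρ, ?_⟩,
    fun v hv i hi j => ?_, ?_, fun s hs => ⟨fun v hv ρ hρ j => ?_, ?_⟩⟩
  · have hlim : Tendsto (fun v : ℝ => ∑ i : SAP N K, 2 * ∑ _j ∈ Finset.univ.erase i,
        2 * √(v / (g m' * (P / K)))) (𝓝[>] 0) (𝓝 0) := by
      refine Tendsto.mono_left ?_ nhdsWithin_le_nhds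
      have hc : Continuous fun v : ℝ => ∑ i : SAP N K, 2 * ∑ _j ∈ Finset.univ.erase i,
        2 * √(v / (g m' * (P / K))) := by fun_prop
      simpa using hc.tendsto 0
    -- The optimum is at most `highSNRInfo` at the waterfilling powers, which exceeds the mutual
    -- information of the softmax weights by at most the vanishing error.
    refine tendsto_of_tendsto_of_tendsto_of_le_of_le' tendsto_const_nhds hlim ?_ ?_
    · filter_upwards [self_mem_nhdsWithin] with v hv
      exact sub_nonneg.2 (hle v hv)
    · filter_upwards [self_mem_nhdsWithin] with v hv
      obtain ⟨p, hp, hpL⟩ := highSNRInfo_le_mutualInfo_add hg hP hv (hw v hv) (hg m') hm'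
      have h1 := mutualInfo_le_optMutualInfoGivenPowers hg hv (hf v hv) hp
      have h2 : optMutualInfo K g P v ≤ highSNRInfo g (w v) v :=
        optMutualInfo_le hP fun p hp ρ hρ => (mutualInfo_le_highSNRInfo hg hv hp hρ).trans
          (highSNRInfo_le_waterfilling hg hP hv (hw v hv) hρ)
      linarith
  · exact (hw v hv i).sum_log_le_of_largest hg hP hv (hw v hv j) (by rw [i.2, j.2]) hi
  · exact isEquivalent_of_log_le_of_le (mul_pos (hg m) hP) fun v hv =>
      ⟨(hlow v hv).trans (hsingle v hv i₀), hle v hv, hup v hv⟩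
  · exact (patternRate_le_waterfilling hg hP hv (hw v hv) hρ j).trans (hs v hv j)
  · refine isEquivalent_of_log_le_of_le (mul_pos (hg m) hP) fun v hv => ?_
    rw [mutualInfo_single hg hv (hf v hv)]
    exact ⟨(hlow v hv).trans (hs v hv i₀), (hsingle v hv _).trans (hle v hv), hup v hv⟩
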